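/- **Setting.** Let $1\le L\le N$ be integers and let $i_1,\dots,i_{N_{\rm B}}\in\{0,\dots,N-1\}$ be distinct subcarrier indices. Bob and Ava use activation patterns (codewords) ${\bf c}_{\rm B},{\bf c}_{\rm A}\in\{0,1\}^{N_{\rm B}}$, which may be arbitrary binary words, in particular any two codewords of an independence-checking code. On subcarrier $i_b$ Bob sends $x_{{\rm B},b}=\sqrt{\rho_{\rm B}}e^{j\phi}$ if $c_{{\rm B},b}=1$ and $0$ otherwise; Ava sends $x_{{\rm A},b}=\sqrt{\rho_{\rm A}}e^{j\varphi_b}$ if $c_{{\rm A},b}=1$ and $0$ otherwise. Here $\rho_{\rm B},\rho_{\rm A}>0$, and the phases $\phi,\varphi_b$ are arbitrary, possibly random. Antenna $m=1,2,\dots$ of the base station receives $$y_{b,m}=x_{{\rm B},b}({\bf F}_{\rm L}{\bf h}_{\rm B}^m)_{i_b}+x_{{\rm A},b}({\bf F}_{\rm L}{\bf h}_{\rm A}^m)_{i_b}+({\bf F}{\bf v}^m)_{i_b},$$ where ${\bf F}$ is the unitary $N\times N$ DFT matrix and ${\bf F}_{\rm L}$ is $\sqrt N$ times its first $L$ columns.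 The families ${\bf h}_{\rm B}$, ${\bf h}_{\rm A}$, ${\bf v}$ are independent of each other and each is a zero-mean circularly symmetric complex Gaussian family. The entries of ${\bf v}$ are i.i.d. with variance $\sigma^2\ge 0$. Different paths are uncorrelated, and for every path the correlation between antennas $m,n$ is the one-ring correlation $$\frac1{2\Delta L}\int_{\theta-\Delta}^{\theta+\Delta}e^{-j2\pi D(m-n)\sin\alpha}\,d\alpha,$$ with $\theta=\theta_1$ for Bob and $\theta=\theta_2$ for Ava, where $D>0$, $\Delta>0$ and $[\theta_k-\Delta,\theta_k+\Delta]\subseteq[-\pi/3,\pi/3]$. **Decoder.** The observed codeword is the number $o_b=c_{{\rm B},b}+c_{{\rm A},b}$ of nodes transmitting on each subcarrier; $b$ is ambiguous if $o_b=1$. Let $r$ be any ambiguous reference position (any position if none is ambiguous). For each ambiguous $b$ the base station measures the inner product exactly under massive antennas, that is, it obtains $$I_{r,b}=\lim_{n\to\infty}\Big\langle \frac{{\bf y}_r^{(n)}}{\|{\bf y}_r^{(n)}\|},\frac{{\bf y}_b^{(n)}}{\|{\bf y}_b^{(n)}\|}\Big\rangle ,\qquad {\bf y}_b^{(n)}=(y_{b,1},\dots,y_{b,n}),$$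 and puts $d_{r,b}=f_d(|I_{r,b}|)\oplus1$ with $f_d(x)=1$ if $x>0$ and $f_d(x)=0$ otherwise. For $a\in\{0,1\}$ the candidate $\overline{\bf c}_a$ has digit $0$ where $o_b=0$, digit $1$ where $o_b=2$, and digit $d_{r,b}\oplus a$ where $b$ is ambiguous. The separation error probability (SEP) is the probability that one of the limits fails to exist or that $\{\overline{\bf c}_0,\overline{\bf c}_1\}\ne\{{\bf c}_{\rm B},{\bf c}_{\rm A}\}$. **Proposition 2.** Assume that $N\nmid L(i_r-i_b)$ for every ambiguous $b\neq r$ on which the same node transmits as on $r$ (so that this node's channels on the two subcarriers are correlated). Then the SEP is zero. -/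

import Mathlib

open MeasureTheory ProbabilityTheory Filter Topology

noncomputable section

namespace ICC

/-! ### Codewords, superposition, and the differential decoder -/

/-- A binary word of length `NB`; digit `true` means that the subcarrier is activated. -/
abbrev Codeword (NB : ℕ) : Type := Fin NB → Bool

/-- The superimposed codeword observed at the base station: the number of nodes
(none, one or two) that transmit on each subcarrier. -/
def observed {NB : ℕ} (cB cA : Codeword NB) : Fin NB → ℕ :=
  fun b => (cB b).toNat + (cA b).toNat

/-- The ambiguous subcarriers of an observation: exactly one (unknown) node transmits. -/
def ambiguous {NB : ℕ} (o : Fin NB → ℕ) : Finset (Fin NB) :=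
  Finset.univ.filter fun b => o b = 1

/-- The threshold decision with threshold zero. -/
def thresholdDigit (x : ℝ) : Bool := decide (0 < x)

/-- The differential digit (threshold decision plus one, modulo two) of a measured
inner product. -/
def diffDigit (I : ℂ) : Bool := xor (thresholdDigit ‖I‖) true

/-- The candidate codeword output under the assumption that the digit of the reference
subcarrier equals `a`. The decoder sees only the observed codeword `o` and the measured
inner products `I b` between the reference subcarrier and the subcarriers `b`. -/
def candidate {NB : ℕ} (o : Fin NB → ℕ) (I : Fin NB → ℂ) (a : Bool) : Codeword NB :=
  fun b => if o b = 0 then false else if o b = 2 then true else xor (diffDigit (I b)) a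

/-- The unordered pair of words into which the decoder separates the observation. -/
def separatedPair {NB : ℕ} (o : Fin NB → ℕ) (I : Fin NB → ℂ) : Sym2 (Codeword NB) :=
  s(candidate o I false, candidate o I true)

/-! ### The OFDM signal model -/

/-- The unitary `N × N` DFT matrix. -/
def dft (N : ℕ) : Matrix (Fin N) (Fin N) ℂ :=
  Matrix.of fun j t =>
    Complex.exp (-(2 * Real.pi * Complex.I * (j : ℕ) * (t : ℕ) / N)) / (Real.sqrt N : ℂ)

/-- `√N` times the first `L` columns of the DFT matrix. -/
def dftL {N L : ℕ} (hLN : L ≤ N) : Matrix (Fin N) (Fin L) ℂ :=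
  (Real.sqrt N : ℂ) • (dft N).submatrix id (Fin.castLE hLN)

/-- The transmitted symbol for a digit: a pilot tone of power `ρ` and phase `φ` if the digit is
one, silence otherwise. -/
def pilot (digit : Bool) (ρ φ : ℝ) : ℂ :=
  if digit then (Real.sqrt ρ : ℂ) * Complex.exp (Complex.I * φ) else 0

/-- Frequency-domain sample at subcarrier `j` of one antenna: `xB`, `xA` are the symbols sent on
this subcarrier, `hB`, `hA` the channel impulse responses to this antenna, and `v` the
time-domain noise vector of this antenna. -/
def received {N L : ℕ} (hLN : L ≤ N) (j : Fin N) (xB xA : ℂ)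
    (hB hA : Fin L → ℂ) (v : Fin N → ℂ) : ℂ :=
  xB * (dftL hLN).mulVec hB j + xA * (dftL hLN).mulVec hA j + (dft N).mulVec v j

/-- Inner product of the normalized received vectors of the first `n` antennas, for the samples
`y` on one subcarrier and `z` on another. -/
def normalizedInner (y z : ℕ → ℂ) (n : ℕ) : ℂ :=
  let u : EuclideanSpace ℂ (Fin n) := WithLp.toLp 2 fun i => y i
  let w : EuclideanSpace ℂ (Fin n) := WithLp.toLp 2 fun i => z i
  inner ℂ ((‖u‖ : ℂ)⁻¹ • u) ((‖w‖ : ℂ)⁻¹ • w)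

/-! ### Fading and noise -/

/-- `X` is a zero-mean circularly symmetric complex Gaussian family with covariance
`E[X s * conj (X t)] = K s t`. -/
structure IsCircularGaussian {Ω T : Type*} [MeasurableSpace Ω] (X : T → Ω → ℂ)
    (K : T → T → ℂ) (μ : Measure Ω) : Prop where
  measurable : ∀ t, Measurable (X t)
  gaussian : IsGaussianProcess X μ
  mean : ∀ t, ∫ ω, X t ω ∂μ = 0
  covariance : ∀ s t, ∫ ω, X s ω * star (X t ω) ∂μ = K s t
  pseudoCovariance : ∀ s t, ∫ ω, X s ω * X t ω ∂μ = 0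

/-- One-ring correlation between antennas `m` and `n` of a uniform linear array with spacing `D`
(in wavelengths), for mean angle of arrival `θ`, angular spread `Δ` and `L` paths. -/
def oneRing (D Δ θ : ℝ) (L : ℕ) (m n : ℕ) : ℂ :=
  (1 / (2 * Δ * L) : ℂ) * ∫ α in (-Δ + θ)..(Δ + θ),
    Complex.exp (-(Complex.I * 2 * Real.pi * D * ((m : ℂ) - n) * Real.sin α))

/-- Covariance of the taps `(antenna, path)`: paths are uncorrelated and equally strong
(power `1 / L` each), antennas are correlated by the one-ring model. -/
def channelCov (D Δ θ : ℝ) (L : ℕ) (p q : ℕ × Fin L) : ℂ :=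
  if p.2 = q.2 then oneRing D Δ θ L p.1 q.1 else 0

/-- Covariance of white noise of power `σ2`, indexed by `(antenna, sample)`. -/
def noiseCov (σ2 : ℝ) (N : ℕ) (p q : ℕ × Fin N) : ℂ :=
  if p = q then (σ2 : ℂ) else 0

/-- Joint law of the channels `hB`, `hA` of the two nodes and of the noise `v`: Rayleigh fading
with one-ring correlation, white Gaussian noise, and independence of the three families. -/
structure IsFadingModel {Ω : Type*} [MeasurableSpace Ω] (μ : Measure Ω) {N L : ℕ}
    (D Δ θB θA σ2 : ℝ) (hB hA : ℕ × Fin L → Ω → ℂ) (v : ℕ × Fin N → Ω → ℂ) : Prop where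
  bob : IsCircularGaussian hB (channelCov D Δ θB L) μ
  ava : IsCircularGaussian hA (channelCov D Δ θA L) μ
  noise : IsCircularGaussian v (noiseCov σ2 N) μ
  indep_channels : IndepFun (fun ω p => hB p ω) (fun ω p => hA p ω) μ
  indep_noise :
    IndepFun (fun ω => ((fun p => hB p ω), (fun p => hA p ω))) (fun ω p => v p ω) μ

/-- The sample received at antenna `i` on the `b`-th pilot subcarrier `Ψ b`, when Bob uses the
activation pattern `cB` with phase `φB` and Ava the pattern `cA` with phases `φA b`. -/
def sample {Ω : Type*} {N L NB : ℕ} (hLN : L ≤ N) (Ψ : Fin NB ↪ Fin N) (ρB ρA : ℝ)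
    (cB cA : Codeword NB) (φB : Ω → ℝ) (φA : Fin NB → Ω → ℝ)
    (hB hA : ℕ × Fin L → Ω → ℂ) (v : ℕ × Fin N → Ω → ℂ) (b : Fin NB) (ω : Ω) (i : ℕ) : ℂ :=
  received hLN (Ψ b) (pilot (cB b) ρB (φB ω)) (pilot (cA b) ρA (φA b ω))
    (fun l => hB (i, l) ω) (fun l => hA (i, l) ω) (fun t => v (i, t) ω)

/-! ### The separation error probability -/

/-- Successful separation with reference subcarrier `r`, for the samples `y b i` (subcarrier `b`,
antenna `i`): the inner products between the reference and the ambiguous subcarriers have exact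
(massive-array) values `I`, and decoding with these returns the two right codewords. -/
def Separated {NB : ℕ} (cB cA : Codeword NB) (r : Fin NB) (y : Fin NB → ℕ → ℂ) : Prop :=
  ∃ I : Fin NB → ℂ,
    (∀ b ∈ ambiguous (observed cB cA),
      Tendsto (normalizedInner (y r) (y b)) atTop (𝓝 (I b))) ∧
    separatedPair (observed cB cA) I = s(cB, cA)

/-- The separation error probability. -/
def sep {Ω : Type*} [MeasurableSpace Ω] (μ : Measure Ω) {NB : ℕ} (cB cA : Codeword NB)
    (r : Fin NB) (y : Fin NB → Ω → ℕ → ℂ) : ENNReal :=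
  μ {ω | ¬ Separated cB cA r (fun b => y b ω)}

end ICC

end

/-! Every received sample is a linear combination, with weights not depending on the antenna, of `L
+ L + N` scalar sources: Bob's paths, Ava's paths and the noise samples. Along the antennas each
source is a stationary circular Gaussian sequence whose covariance is dominated by the inverse lag.
For the channels this is a van der Corput estimate of the one-ring integral, whose phase has no
stationary point in the allowed sector. Inverse-lag decay is square summable, so a strong law for
products holds (`ae_tendsto_average_mul_star`), and almost surely all empirical correlations between
sources converge, to a diagonal limit.

On that event, which does not involve the phases, everything is deterministic. The normalized inner
product of two ambiguous subcarriers tends to a multiple of the correlation of their symbols times a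
geometric sum of roots of unity. The symbol factor vanishes exactly when different nodes transmit;
the geometric sum is nonzero when `N` does not divide `L * (j - k)` (`sum_star_dftL_mul_ne_zero`).
The zero threshold thus reads off which ambiguous subcarriers share the reference's node, which
suffices for decoding (`separatedPair_observed`). -/

noncomputable section

namespace ICC

/-! ### Strong law for squares of weakly correlated real Gaussian sequences -/

section RealGaussian

variable {Ω : Type*} [MeasurableSpace Ω] {μ : Measure Ω}

/-- Differentiation preserves the form polynomial times Gaussian exponential, acting on the
polynomial by `p ↦ p' + v t p`. Iterating this gives moments from the moment generating function. -/
lemma deriv_mul_gaussianExp (v : ℝ) {p p' q : ℝ → ℝ} (hp : ∀ t, HasDerivAt p (p' t) t)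
    (hq : ∀ t, p' t + v * t * p t = q t) :
    deriv (fun t => p t * Real.exp (v * t ^ 2 / 2)) =
      fun t => q t * Real.exp (v * t ^ 2 / 2) := by
  ext t
  have h1 : HasDerivAt (fun t : ℝ => v * t ^ 2 / 2) (v * t) t := by
    refine (((hasDerivAt_pow 2 t).const_mul v).div_const 2).congr_deriv ?_
    push_cast
    ring
  rw [((hp t).fun_mul h1.exp).deriv, ← hq t]
  ring

lemma integral_pow_four_gaussianReal (v : NNReal) :
    ∫ x, x ^ 4 ∂(gaussianReal 0 v) = 3 * (v : ℝ) ^ 2 := by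
  have h : ∫ x, x ^ 4 ∂(gaussianReal 0 v) =
      iteratedDeriv 4 (mgf (fun x ↦ x) (gaussianReal 0 v)) 0 := by
    rw [iteratedDeriv_mgf_zero] <;> simp
  have h0 : mgf (fun x ↦ x) (gaussianReal 0 v) =
      fun t : ℝ => (1 : ℝ) * Real.exp (v * t ^ 2 / 2) := by
    rw [mgf_fun_id_gaussianReal]; simp
  rw [h, h0]
  simp only [iteratedDeriv_succ', iteratedDeriv_zero]
  rw [deriv_mul_gaussianExp (v : ℝ) (p' := fun _ => 0) (q := fun t => v * t)
      (fun t => hasDerivAt_const t 1) (fun t => by ring),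
    deriv_mul_gaussianExp (v : ℝ) (p' := fun _ => v) (q := fun t => v + v ^ 2 * t ^ 2)
      (fun t => by simpa using (hasDerivAt_id t).const_mul (v : ℝ)) (fun t => by ring),
    deriv_mul_gaussianExp (v : ℝ) (p' := fun t => 2 * v ^ 2 * t)
      (q := fun t => 3 * v ^ 2 * t + v ^ 3 * t ^ 3)
      (fun t => (((hasDerivAt_pow 2 t).const_mul ((v : ℝ) ^ 2)).const_add (v : ℝ)).congr_deriv
        (by push_cast; ring)) (fun t => by ring),
    deriv_mul_gaussianExp (v : ℝ) (p := fun t => 3 * v ^ 2 * t + v ^ 3 * t ^ 3)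
      (p' := fun t => 3 * v ^ 2 + 3 * v ^ 3 * t ^ 2)
      (q := fun t => 3 * v ^ 2 + 6 * v ^ 3 * t ^ 2 + v ^ 4 * t ^ 4)
      (fun t => (((hasDerivAt_id t).const_mul (3 * (v : ℝ) ^ 2)).fun_add
        ((hasDerivAt_pow 3 t).const_mul ((v : ℝ) ^ 3))).congr_deriv (by push_cast; ring))
      (fun t => by ring)]
  simp

lemma integral_pow_four_of_hasGaussianLaw {G : Ω → ℝ} (hG : HasGaussianLaw G μ)
    (h0 : ∫ ω, G ω ∂μ = 0) : ∫ ω, G ω ^ 4 ∂μ = 3 * (∫ ω, G ω ^ 2 ∂μ) ^ 2 := by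
  have hm := hG.map_eq_gaussianReal
  have hv : Var[G; μ] = ∫ ω, G ω ^ 2 ∂μ := by
    rw [variance_eq_integral hG.aemeasurable, h0]; simp
  have h4 : ∫ ω, G ω ^ 4 ∂μ = ∫ x, x ^ 4 ∂(μ.map G) := by
    rw [integral_map hG.aemeasurable (by fun_prop)]
  rw [h4, hm, h0, integral_pow_four_gaussianReal, Real.coe_toNNReal _ (variance_nonneg _ _), hv]

lemma memLp_sq_of_hasGaussianLaw {G : Ω → ℝ} (hG : HasGaussianLaw G μ) :
    MemLp (fun ω => G ω ^ 2) 2 μ := by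
  have h4 : MemLp G 4 μ := hG.memLp (by norm_num)
  rw [memLp_two_iff_integrable_sq (by have := hG.aemeasurable; fun_prop)]
  have := h4.integrable_norm_rpow (by norm_num) (by norm_num)
  refine this.congr (ae_of_all _ fun ω => ?_)
  simp only [Real.norm_eq_abs, ENNReal.toReal_ofNat]
  rw [show (4 : ℝ) = ((4 : ℕ) : ℝ) by norm_num, Real.rpow_natCast, Even.pow_abs (by decide)]
  ring

lemma integrable_pow_four_of_hasGaussianLaw {G : Ω → ℝ} (hG : HasGaussianLaw G μ) :
    Integrable (fun ω => G ω ^ 4) μ := by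
  refine (memLp_sq_of_hasGaussianLaw hG).integrable_sq.congr (ae_of_all _ fun ω => ?_)
  ring

/-- Isserlis' formula for the squares of a centred Gaussian pair. -/
lemma integral_sq_mul_sq_of_hasGaussianLaw {G H : Ω → ℝ}
    (hGH : HasGaussianLaw (fun ω => (G ω, H ω)) μ)
    (hG0 : ∫ ω, G ω ∂μ = 0) (hH0 : ∫ ω, H ω ∂μ = 0) :
    ∫ ω, G ω ^ 2 * H ω ^ 2 ∂μ =
      (∫ ω, G ω ^ 2 ∂μ) * (∫ ω, H ω ^ 2 ∂μ) + 2 * (∫ ω, G ω * H ω ∂μ) ^ 2 := by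
  have hG := hGH.fst
  have hH := hGH.snd
  have iG := hG.integrable
  have iH := hH.integrable
  have i2G := hG.memLp_two.integrable_sq
  have i2H := hH.memLp_two.integrable_sq
  have iGH : Integrable (fun ω => G ω * H ω) μ := hG.memLp_two.integrable_mul hH.memLp_two
  have i22 : Integrable (fun ω => G ω ^ 2 * H ω ^ 2) μ :=
    (memLp_sq_of_hasGaussianLaw hG).integrable_mul (memLp_sq_of_hasGaussianLaw hH)
  have i4G := integrable_pow_four_of_hasGaussianLaw hG
  have i4H := integrable_pow_four_of_hasGaussianLaw hH
  -- The sum and the difference are Gaussian too. Adding their fourth moments cancels the odd terms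
  -- and isolates the mixed moment.
  have hp := integral_pow_four_of_hasGaussianLaw hGH.fun_add (by rw [integral_add iG iH]; simp [*])
  have hm := integral_pow_four_of_hasGaussianLaw hGH.fun_sub (by rw [integral_sub iG iH]; simp [*])
  have i4p := integrable_pow_four_of_hasGaussianLaw hGH.fun_add
  have i4m := integrable_pow_four_of_hasGaussianLaw hGH.fun_sub
  have h4G := integral_pow_four_of_hasGaussianLaw hG hG0
  have h4H := integral_pow_four_of_hasGaussianLaw hH hH0
  have e2p : ∫ ω, (G ω + H ω) ^ 2 ∂μ =
      ∫ ω, G ω ^ 2 ∂μ + ∫ ω, H ω ^ 2 ∂μ + 2 * ∫ ω, G ω * H ω ∂μ := by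
    rw [← integral_const_mul, ← integral_add i2G i2H,
      ← integral_add (i2G.fun_add i2H) (iGH.const_mul 2)]
    congr with ω; ring
  have e2m : ∫ ω, (G ω - H ω) ^ 2 ∂μ =
      ∫ ω, G ω ^ 2 ∂μ + ∫ ω, H ω ^ 2 ∂μ - 2 * ∫ ω, G ω * H ω ∂μ := by
    rw [← integral_const_mul, ← integral_add i2G i2H,
      ← integral_sub (i2G.fun_add i2H) (iGH.const_mul 2)]
    congr with ω; ring
  have e4 : ∫ ω, (G ω + H ω) ^ 4 ∂μ + ∫ ω, (G ω - H ω) ^ 4 ∂μ =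
      2 * ∫ ω, G ω ^ 4 ∂μ + 12 * ∫ ω, G ω ^ 2 * H ω ^ 2 ∂μ + 2 * ∫ ω, H ω ^ 4 ∂μ := by
    rw [← integral_add i4p i4m, ← integral_const_mul, ← integral_const_mul, ← integral_const_mul,
      ← integral_add (i4G.const_mul 2) (i22.const_mul 12),
      ← integral_add ((i4G.const_mul 2).fun_add (i22.const_mul 12)) (i4H.const_mul 2)]
    congr with ω; ring
  rw [hp, hm, e2p, e2m, h4G, h4H] at e4
  linarith

/-- Centring removes the product of variances from Isserlis' formula. Only the squared covariance is
left, which turns inverse-lag decay into summable decay. -/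
lemma integral_centredSq_mul_centredSq {G H : Ω → ℝ} [IsProbabilityMeasure μ]
    (hGH : HasGaussianLaw (fun ω => (G ω, H ω)) μ)
    (hG0 : ∫ ω, G ω ∂μ = 0) (hH0 : ∫ ω, H ω ∂μ = 0) {s : ℝ}
    (hG2 : ∫ ω, G ω ^ 2 ∂μ = s) (hH2 : ∫ ω, H ω ^ 2 ∂μ = s) :
    ∫ ω, (G ω ^ 2 - s) * (H ω ^ 2 - s) ∂μ = 2 * (∫ ω, G ω * H ω ∂μ) ^ 2 := by
  have h := integral_sq_mul_sq_of_hasGaussianLaw hGH hG0 hH0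
  have i2G := hGH.fst.memLp_two.integrable_sq
  have i2H := hGH.snd.memLp_two.integrable_sq
  have i22 : Integrable (fun ω => G ω ^ 2 * H ω ^ 2) μ :=
    (memLp_sq_of_hasGaussianLaw hGH.fst).integrable_mul (memLp_sq_of_hasGaussianLaw hGH.snd)
  have e : (fun ω => (G ω ^ 2 - s) * (H ω ^ 2 - s)) =
      fun ω => (G ω ^ 2 * H ω ^ 2 - s * G ω ^ 2) - (s * H ω ^ 2 - s ^ 2) := by
    ext ω; ring
  have i1 : Integrable (fun ω => G ω ^ 2 * H ω ^ 2 - s * G ω ^ 2) μ := i22.sub (i2G.const_mul s)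
  have i2 : Integrable (fun ω => s * H ω ^ 2 - s ^ 2) μ :=
    (i2H.const_mul s).sub (integrable_const _)
  rw [e, integral_sub i1 i2,
    integral_sub i22 (i2G.const_mul s), integral_sub (i2H.const_mul s) (integrable_const _),
    integral_const_mul, integral_const_mul, h, hG2, hH2]
  simp
  ring

lemma summable_inv_one_add_abs_sq : Summable fun k : ℤ => ((1 + |(k : ℝ)|) ^ 2)⁻¹ := by
  have h : Summable fun n : ℕ => ((1 + |((n : ℤ) : ℝ)|) ^ 2)⁻¹ := by
    have := (summable_nat_add_iff 1).2 (Real.summable_nat_pow_inv.2 (one_lt_two))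
    refine this.congr fun n => ?_
    simp [add_comm]
  refine Summable.of_nat_of_neg h ?_
  simpa using h

lemma exists_sum_inv_one_add_abs_sq_le :
    ∃ B : ℝ, 0 ≤ B ∧ ∀ m N : ℕ,
      ∑ n ∈ Finset.range N, ((1 + |(m : ℝ) - n|) ^ 2)⁻¹ ≤ B := by
  -- Substituting `k = m - n` embeds each row sum into one series over `ℤ`, whence uniformity in
  -- `m`.
  refine ⟨∑' k : ℤ, ((1 + |(k : ℝ)|) ^ 2)⁻¹, tsum_nonneg fun _ => by positivity, fun m N => ?_⟩
  have hinj : Function.Injective fun n : ℕ => (m : ℤ) - n := fun a b h => by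
    simpa using h
  have hs := summable_inv_one_add_abs_sq
  have h1 := (hs.comp_injective hinj).sum_le_tsum (Finset.range N) (fun _ _ => by
    simp only [Function.comp]; positivity)
  have h2 := tsum_comp_le_tsum_of_inj hs (fun _ => by positivity) hinj
  refine le_trans (le_of_eq ?_) (h1.trans h2)
  simp

variable [IsProbabilityMeasure μ]

/-- Each row of squared covariances has a bounded sum, so the second moment of the centred sum grows
only linearly. -/
lemma exists_integral_sum_centredSq_sq_le {G : ℕ → Ω → ℝ} (hG : IsGaussianProcess G μ)
    (h0 : ∀ m, ∫ ω, G m ω ∂μ = 0) {s C : ℝ} (h2 : ∀ m, ∫ ω, G m ω ^ 2 ∂μ = s)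
    (hC : ∀ m n : ℕ, |∫ ω, G m ω * G n ω ∂μ| * (1 + |(m : ℝ) - n|) ≤ C) :
    ∃ B : ℝ, ∀ N : ℕ,
      Integrable (fun ω => (∑ m ∈ Finset.range N, (G m ω ^ 2 - s)) ^ 2) μ ∧
      ∫ ω, (∑ m ∈ Finset.range N, (G m ω ^ 2 - s)) ^ 2 ∂μ ≤ B * N := by
  obtain ⟨B, hB0, hB⟩ := exists_sum_inv_one_add_abs_sq_le
  have hL2 : ∀ m, MemLp (fun ω => G m ω ^ 2 - s) 2 μ := fun m =>
    (memLp_sq_of_hasGaussianLaw (hG.hasGaussianLaw_eval m)).sub (memLp_const s)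
  have hint : ∀ m n, Integrable (fun ω => (G m ω ^ 2 - s) * (G n ω ^ 2 - s)) μ := fun m n =>
    (hL2 m).integrable_mul (hL2 n)
  refine ⟨2 * C ^ 2 * B, fun N => ⟨?_, ?_⟩⟩
  · exact (memLp_finsetSum (Finset.range N) fun m _ => hL2 m).integrable_sq
  have e : ∫ ω, (∑ m ∈ Finset.range N, (G m ω ^ 2 - s)) ^ 2 ∂μ =
      ∑ m ∈ Finset.range N, ∑ n ∈ Finset.range N, 2 * (∫ ω, G m ω * G n ω ∂μ) ^ 2 := by
    simp_rw [sq (∑ m ∈ Finset.range N, _), Finset.sum_mul_sum]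
    rw [integral_finsetSum _ fun m _ => integrable_finsetSum _ fun n _ => hint m n]
    refine Finset.sum_congr rfl fun m _ => ?_
    rw [integral_finsetSum _ fun n _ => hint m n]
    exact Finset.sum_congr rfl fun n _ =>
      integral_centredSq_mul_centredSq hG.hasGaussianLaw_prodMk (h0 m) (h0 n) (h2 m) (h2 n)
  rw [e]
  have hterm : ∀ m n : ℕ, 2 * (∫ ω, G m ω * G n ω ∂μ) ^ 2 ≤
      2 * C ^ 2 * ((1 + |(m : ℝ) - n|) ^ 2)⁻¹ := by
    intro m n
    have hpos : 0 < 1 + |(m : ℝ) - n| := by positivity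
    rw [← div_eq_mul_inv, le_div_iff₀ (by positivity), mul_assoc, ← sq_abs (∫ ω, _ ∂μ), ← mul_pow]
    have := hC m n
    gcongr
  calc _ ≤ ∑ m ∈ Finset.range N, 2 * C ^ 2 * B := by
        refine Finset.sum_le_sum fun m _ => ?_
        refine (Finset.sum_le_sum fun n _ => hterm m n).trans ?_
        rw [← Finset.mul_sum]
        exact mul_le_mul_of_nonneg_left (hB m N) (by positivity)
    _ = 2 * C ^ 2 * B * N := by simp; ring

/-- Strong law of large numbers for the squares of a centred Gaussian sequence with constant
variance and covariances that decay like the inverse lag. -/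
theorem ae_tendsto_average_sq {G : ℕ → Ω → ℝ} (hG : IsGaussianProcess G μ)
    (h0 : ∀ m, ∫ ω, G m ω ∂μ = 0) {s C : ℝ} (h2 : ∀ m, ∫ ω, G m ω ^ 2 ∂μ = s)
    (hC : ∀ m n : ℕ, |∫ ω, G m ω * G n ω ∂μ| * (1 + |(m : ℝ) - n|) ≤ C) :
    ∀ᵐ ω ∂μ, Tendsto (fun N : ℕ => (∑ m ∈ Finset.range N, G m ω ^ 2) / N) atTop (𝓝 s) := by
  obtain ⟨B, hB⟩ := exists_integral_sum_centredSq_sq_le hG h0 h2 hC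
  -- Along the square numbers `(k + 1) ^ 2` the mean square of the centred average is `O((k +
  -- 1)⁻²)`. This is summable, so `Z k` is almost surely summable and tends to zero, without any
  -- independence.
  set Z : ℕ → Ω → ℝ := fun k ω =>
    ((∑ m ∈ Finset.range ((k + 1) ^ 2), (G m ω ^ 2 - s)) / ((k + 1) ^ 2 : ℕ)) ^ 2 with hZ
  have hZi : ∀ k, Integrable (Z k) μ := fun k => by
    simp only [hZ, div_pow]
    exact (hB _).1.div_const _
  have hZb : ∀ k, ∫ ω, Z k ω ∂μ ≤ B * (((k + 1 : ℕ) : ℝ) ^ 2)⁻¹ := fun k => by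
    simp only [hZ, div_pow]
    rw [integral_div, div_le_iff₀ (by positivity)]
    refine (hB _).2.trans (le_of_eq ?_)
    push_cast
    field_simp
  have hsum : ∀ᵐ ω ∂μ, Summable fun k => ‖Z k ω‖ := by
    refine summable_norm_of_tsum_eLpNorm_ne_top le_rfl (fun k => (hZi k).aestronglyMeasurable) ?_
    have hs : Summable fun k => ∫ ω, Z k ω ∂μ := by
      refine Summable.of_nonneg_of_le (fun k => integral_nonneg fun ω => sq_nonneg _) hZb ?_
      exact ((summable_nat_add_iff 1).2 (Real.summable_nat_pow_inv.2 one_lt_two)).mul_left B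
    convert hs.tsum_ofReal_ne_top with k
    rw [eLpNorm_one_eq_lintegral_enorm,
      ofReal_integral_eq_lintegral_ofReal (hZi k) (ae_of_all _ fun ω => sq_nonneg _)]
    refine lintegral_congr fun ω => ?_
    rw [Real.enorm_eq_ofReal (sq_nonneg _)]
  filter_upwards [hsum] with ω hω
  -- Partial sums of squares are monotone, and consecutive square numbers have ratio tending to one,
  -- so convergence along them extends to all `N`.
  refine tendsto_div_of_monotone_of_exists_subseq_tendsto_div
    (fun N => ∑ m ∈ Finset.range N, G m ω ^ 2) s ?_ ?_
  · exact monotone_nat_of_le_succ fun n => by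
      rw [Finset.sum_range_succ]; linarith [sq_nonneg (G n ω)]
  intro a ha
  refine ⟨fun k => (k + 1) ^ 2, ?_, ?_, ?_⟩
  · have hlim : Tendsto (fun k : ℕ => ((1 : ℝ) + 1 / ((k : ℝ) + 1)) ^ 2) atTop (𝓝 ((1 + 0) ^ 2)) :=
      (tendsto_const_nhds.add tendsto_one_div_add_atTop_nhds_zero_nat).pow 2
    have : ∀ᶠ k : ℕ in atTop, ((1 : ℝ) + 1 / ((k : ℝ) + 1)) ^ 2 < a :=
      hlim.eventually_lt_const (by simpa using ha)
    filter_upwards [this] with k hk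
    push_cast
    have hk1 : (0 : ℝ) < (k : ℝ) + 1 := by positivity
    calc ((k : ℝ) + 1 + 1) ^ 2 = ((1 : ℝ) + 1 / ((k : ℝ) + 1)) ^ 2 * ((k : ℝ) + 1) ^ 2 := by
          field_simp
      _ ≤ a * ((k : ℝ) + 1) ^ 2 := by gcongr
  · exact (tendsto_pow_atTop two_ne_zero).comp (tendsto_add_atTop_nat 1)
  · have hZ0 : Tendsto (fun k => Z k ω) atTop (𝓝 0) :=
      tendsto_zero_iff_norm_tendsto_zero.2 hω.tendsto_atTop_zero
    have h1 : Tendsto (fun k : ℕ =>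
        (∑ m ∈ Finset.range ((k + 1) ^ 2), (G m ω ^ 2 - s)) / ((k + 1) ^ 2 : ℕ)) atTop (𝓝 0) := by
      have := hZ0.sqrt
      rw [Real.sqrt_zero] at this
      simp only [hZ, Real.sqrt_sq_eq_abs] at this
      exact tendsto_zero_iff_abs_tendsto_zero _ |>.2 this
    have h2 := h1.add_const s
    rw [zero_add] at h2
    refine h2.congr fun k => ?_
    rw [Finset.sum_sub_distrib]
    simp
    field_simp
    ring

end RealGaussian

/-! ### Strong law for products in a circular Gaussian family -/

section ComplexGaussian

variable {Ω T : Type*} [MeasurableSpace Ω] {μ : Measure Ω}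

namespace IsCircularGaussian

variable {X : T → Ω → ℂ} {K : T → T → ℂ}

lemma memLp_two (hX : IsCircularGaussian X K μ) (t : T) : MemLp (X t) 2 μ :=
  (hX.gaussian.hasGaussianLaw_eval t).memLp_two

lemma integrable (hX : IsCircularGaussian X K μ) (t : T) : Integrable (X t) μ :=
  (hX.gaussian.hasGaussianLaw_eval t).integrable

lemma integrable_mul (hX : IsCircularGaussian X K μ) (s t : T) :
    Integrable (fun ω => X s ω * X t ω) μ :=
  (hX.memLp_two s).integrable_mul (hX.memLp_two t)

lemma integrable_mul_star (hX : IsCircularGaussian X K μ) (s t : T) :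
    Integrable (fun ω => X s ω * star (X t ω)) μ :=
  (hX.memLp_two s).integrable_mul (hX.memLp_two t).star

lemma covariance_swap (hX : IsCircularGaussian X K μ) (s t : T) : K t s = star (K s t) := by
  rw [← hX.covariance, ← hX.covariance, Complex.star_def, ← integral_conj]
  congr with ω
  simp [mul_comm]

lemma integral_re_mul_re (hX : IsCircularGaussian X K μ) (s t : T) :
    ∫ ω, (X s ω).re * (X t ω).re ∂μ = (K s t).re / 2 := by
  have h1 : ∫ ω, (X s ω * star (X t ω)).re ∂μ = (K s t).re := by
    rw [← hX.covariance s t]; exact integral_re (hX.integrable_mul_star s t)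
  have h2 : ∫ ω, (X s ω * X t ω).re ∂μ = 0 := by
    have := integral_re (hX.integrable_mul s t)
    rw [hX.pseudoCovariance] at this
    exact this
  -- `Re (z w̄) + Re (z w) = 2 Re z Re w`; circularity makes the second term vanish in the mean.
  have h3 := integral_add (hX.integrable_mul_star s t).re (hX.integrable_mul s t).re
  simp only [RCLike.re_to_complex] at h3
  rw [h1, h2, add_zero] at h3
  rw [← h3, eq_div_iff two_ne_zero, ← integral_mul_const]
  congr with ω
  simp
  ring

lemma integral_im_mul_im (hX : IsCircularGaussian X K μ) (s t : T) :
    ∫ ω, (X s ω).im * (X t ω).im ∂μ = (K s t).re / 2 := by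
  have h1 : ∫ ω, (X s ω * star (X t ω)).re ∂μ = (K s t).re := by
    rw [← hX.covariance s t]; exact integral_re (hX.integrable_mul_star s t)
  have h2 : ∫ ω, (X s ω * X t ω).re ∂μ = 0 := by
    have := integral_re (hX.integrable_mul s t)
    rw [hX.pseudoCovariance] at this
    exact this
  have h3 := integral_sub (hX.integrable_mul_star s t).re (hX.integrable_mul s t).re
  simp only [RCLike.re_to_complex] at h3
  rw [h1, h2, sub_zero] at h3
  rw [← h3, eq_div_iff two_ne_zero, ← integral_mul_const]
  congr with ω
  simp
  ring

/-- Strong law of large numbers for the powers of a circular Gaussian sequence. -/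
theorem ae_tendsto_average_normSq [IsProbabilityMeasure μ] {Y : ℕ → Ω → ℂ} {K : ℕ → ℕ → ℂ}
    (hY : IsCircularGaussian Y K μ) {κ : ℂ} {C : ℝ} (hκ : ∀ m, K m m = κ)
    (hC : ∀ m n : ℕ, ‖K m n‖ * (1 + |(m : ℝ) - n|) ≤ C) :
    ∀ᵐ ω ∂μ, Tendsto (fun N : ℕ => (∑ m ∈ Finset.range N, Complex.normSq (Y m ω)) / N)
      atTop (𝓝 κ.re) := by
  have hbound : ∀ m n : ℕ, |(K m n).re / 2| * (1 + |(m : ℝ) - n|) ≤ C := fun m n => by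
    refine le_trans ?_ (hC m n)
    gcongr
    rw [abs_div, abs_two]
    have := Complex.abs_re_le_norm (K m n)
    have := abs_nonneg (K m n).re
    linarith
  have hre := ae_tendsto_average_sq (G := fun m ω => (Y m ω).re) (s := κ.re / 2) (C := C)
    (hY.gaussian.comp_left fun _ => Complex.reCLM)
    (fun m => by
      have := integral_re (hY.integrable m)
      rw [hY.mean] at this
      exact this)
    (fun m => by simp_rw [sq]; rw [hY.integral_re_mul_re, hκ])
    (fun m n => by rw [hY.integral_re_mul_re]; exact hbound m n)
  have him := ae_tendsto_average_sq (G := fun m ω => (Y m ω).im) (s := κ.re / 2) (C := C)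
    (hY.gaussian.comp_left fun _ => Complex.imCLM)
    (fun m => by
      have := integral_im (hY.integrable m)
      rw [hY.mean] at this
      exact this)
    (fun m => by simp_rw [sq]; rw [hY.integral_im_mul_im, hκ])
    (fun m n => by rw [hY.integral_im_mul_im]; exact hbound m n)
  filter_upwards [hre, him] with ω h1 h2
  have h := h1.add h2
  rw [add_halves] at h
  refine h.congr fun N => ?_
  rw [← add_div, ← Finset.sum_add_distrib]
  simp [Complex.normSq_apply, sq]

/-- These are the sequences that occur in the polarization identity, so the strong law for powers
applies to them. -/
lemma add_const_mul (hX : IsCircularGaussian X K μ) {S : Type*} (p q : S → T) (ε : ℂ) :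
    IsCircularGaussian (fun m ω => X (p m) ω + ε * X (q m) ω)
      (fun m n => K (p m) (p n) + star ε * K (p m) (q n) + ε * K (q m) (p n) +
        ε * star ε * K (q m) (q n)) μ where
  measurable m := (hX.measurable _).add ((hX.measurable _).const_mul ε)
  gaussian := by
    classical
    refine hX.gaussian.of_isGaussianProcess fun m => ⟨{p m, q m},
      ContinuousLinearMap.proj ⟨p m, by simp⟩ +
        ε • (ContinuousLinearMap.proj ⟨q m, by simp⟩), fun ω => ?_⟩
    simp
  mean m := by
    rw [integral_add (hX.integrable _) ((hX.integrable _).const_mul ε), integral_const_mul,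
      hX.mean, hX.mean]
    simp
  covariance m n := by
    have i := hX.integrable_mul_star
    rw [← hX.covariance (p m) (p n), ← hX.covariance (p m) (q n), ← hX.covariance (q m) (p n),
      ← hX.covariance (q m) (q n), ← integral_const_mul, ← integral_const_mul,
      ← integral_const_mul, ← integral_add (i _ _) ((i _ _).const_mul _),
      ← integral_add ((i _ _).fun_add ((i _ _).const_mul _)) ((i _ _).const_mul _),
      ← integral_add (((i _ _).fun_add ((i _ _).const_mul _)).fun_add ((i _ _).const_mul _))
        ((i _ _).const_mul _)]
    congr with ω
    simp
    ring
  pseudoCovariance m n := by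
    have i := hX.integrable_mul
    have e : ∀ ω, (X (p m) ω + ε * X (q m) ω) * (X (p n) ω + ε * X (q n) ω) =
        X (p m) ω * X (p n) ω + ε * (X (p m) ω * X (q n) ω) + ε * (X (q m) ω * X (p n) ω) +
          ε * ε * (X (q m) ω * X (q n) ω) := fun ω => by ring
    simp_rw [e]
    rw [integral_add (((i _ _).fun_add ((i _ _).const_mul _)).fun_add ((i _ _).const_mul _))
        ((i _ _).const_mul _),
      integral_add ((i _ _).fun_add ((i _ _).const_mul _)) ((i _ _).const_mul _),
      integral_add (i _ _) ((i _ _).const_mul _), integral_const_mul, integral_const_mul,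
      integral_const_mul]
    simp [hX.pseudoCovariance]

lemma mul_star_eq_polarization (z w : ℂ) :
    z * star w = (Complex.normSq (z + 1 * w) - Complex.normSq (z + (-1) * w) +
      Complex.I * Complex.normSq (z + Complex.I * w) -
      Complex.I * Complex.normSq (z + (-Complex.I) * w)) / 4 := by
  apply Complex.ext <;> simp [Complex.normSq_apply] <;> ring

/-- Strong law of large numbers for the products of two sequences from a circular Gaussian
family. -/
theorem ae_tendsto_average_mul_star [IsProbabilityMeasure μ] (hX : IsCircularGaussian X K μ)
    (p q : ℕ → T) {a b κ : ℂ} {C : ℝ} (ha : ∀ m, K (p m) (p m) = a) (hb : ∀ m, K (q m) (q m) = b)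
    (hκ : ∀ m, K (p m) (q m) = κ)
    (hpp : ∀ m n : ℕ, ‖K (p m) (p n)‖ * (1 + |(m : ℝ) - n|) ≤ C)
    (hqq : ∀ m n : ℕ, ‖K (q m) (q n)‖ * (1 + |(m : ℝ) - n|) ≤ C)
    (hpq : ∀ m n : ℕ, ‖K (p m) (q n)‖ * (1 + |(m : ℝ) - n|) ≤ C) :
    ∀ᵐ ω ∂μ, Tendsto (fun N : ℕ => (∑ m ∈ Finset.range N, X (p m) ω * star (X (q m) ω)) / N)
      atTop (𝓝 κ) := by
  have hqp : ∀ m n : ℕ, ‖K (q m) (p n)‖ * (1 + |(m : ℝ) - n|) ≤ C := fun m n => by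
    rw [hX.covariance_swap (p n) (q m), norm_star, abs_sub_comm]
    exact hpq n m
  have key : ∀ ε : ℂ, ‖ε‖ = 1 → ∀ᵐ ω ∂μ, Tendsto (fun N : ℕ =>
      (∑ m ∈ Finset.range N, Complex.normSq (X (p m) ω + ε * X (q m) ω)) / N)
      atTop (𝓝 (a + star ε * κ + ε * star κ + ε * star ε * b).re) := by
    intro ε hε
    -- One `C` for each of the four covariance terms, whose coefficients have modulus one.
    refine (hX.add_const_mul p q ε).ae_tendsto_average_normSq (C := C + C + C + C) ?_ ?_
    · intro m
      rw [ha, hb, hκ, hX.covariance_swap (p m) (q m), hκ]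
    · intro m n
      refine (mul_le_mul_of_nonneg_right norm_add₄_le (by positivity)).trans ?_
      simp only [norm_mul, norm_star, hε, one_mul, add_mul]
      exact add_le_add (add_le_add (add_le_add (hpp m n) (hpq m n)) (hqp m n)) (hqq m n)
  filter_upwards [key 1 (by simp), key (-1) (by simp), key Complex.I (by simp),
    key (-Complex.I) (by simp)] with ω h1 h2 h3 h4
  have c := fun {f : ℕ → ℝ} {x : ℝ} (h : Tendsto f atTop (𝓝 x)) =>
    (Complex.continuous_ofReal.tendsto x).comp h
  have h := ((((c h1).sub (c h2)).add ((c h3).const_mul Complex.I)).sub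
    ((c h4).const_mul Complex.I)).div_const 4
  -- The same polarization on the level of limits: `a` and `b` cancel between `ε` and `-ε`.
  have hl : κ = (((a + star 1 * κ + 1 * star κ + 1 * star 1 * b).re : ℂ) -
      ((a + star (-1) * κ + (-1) * star κ + (-1) * star (-1) * b).re : ℂ) +
      Complex.I * ((a + star Complex.I * κ + Complex.I * star κ +
        Complex.I * star Complex.I * b).re : ℂ) -
      Complex.I * ((a + star (-Complex.I) * κ + (-Complex.I) * star κ +
        (-Complex.I) * star (-Complex.I) * b).re : ℂ)) / 4 := by
    apply Complex.ext <;> simp <;> ring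
  rw [← hl] at h
  refine h.congr fun N => ?_
  simp_rw [mul_star_eq_polarization]
  rw [← Finset.sum_div, Finset.sum_sub_distrib, Finset.sum_add_distrib, Finset.sum_sub_distrib,
    ← Finset.mul_sum, ← Finset.mul_sum]
  simp only [Function.comp, Complex.ofReal_div, Complex.ofReal_sum, Complex.ofReal_natCast]
  ring

end IsCircularGaussian

/-- Two independent Gaussian processes are jointly Gaussian. -/
lemma isGaussianProcess_sumElim {S : Type*} {X : S → Ω → ℂ} {Y : T → Ω → ℂ}
    (hX : IsGaussianProcess X μ) (hY : IsGaussianProcess Y μ)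
    (hXY : IndepFun (fun ω s => X s ω) (fun ω t => Y t ω) μ) :
    IsGaussianProcess (Sum.elim X Y) μ where
  hasGaussianLaw I := by
    have hind : IndepFun (fun ω => I.toLeft.restrict (X · ω)) (fun ω => I.toRight.restrict (Y · ω))
        μ := hXY.comp (Finset.measurable_restrict _) (Finset.measurable_restrict _)
    have h := hind.hasGaussianLaw (hX.hasGaussianLaw I.toLeft) (hY.hasGaussianLaw I.toRight)
    let L : ((I.toLeft → ℂ) × (I.toRight → ℂ)) →L[ℝ] (I → ℂ) :=
      ContinuousLinearMap.pi fun i => match i with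
        | ⟨.inl s, hs⟩ => (ContinuousLinearMap.proj ⟨s, by simpa using hs⟩).comp
            (ContinuousLinearMap.fst ℝ _ _)
        | ⟨.inr t, ht⟩ => (ContinuousLinearMap.proj ⟨t, by simpa using ht⟩).comp
            (ContinuousLinearMap.snd ℝ _ _)
    have e : (fun ω => I.restrict (Sum.elim X Y · ω)) = L ∘ fun ω =>
        (I.toLeft.restrict (X · ω), I.toRight.restrict (Y · ω)) := by
      funext ω i
      obtain ⟨s | t, hi⟩ := i <;> rfl
    rw [e]
    exact h.map L

/-- Covariance of the union of two independent centred families. -/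
def blockCov {S : Type*} (K : S → S → ℂ) (K' : T → T → ℂ) : S ⊕ T → S ⊕ T → ℂ
  | .inl s, .inl s' => K s s'
  | .inr t, .inr t' => K' t t'
  | _, _ => 0

/-- Independence and zero means kill all cross terms, in the covariance and in the
pseudo-covariance. This lets channels and noise be treated as one family. -/
lemma IsCircularGaussian.sumElim {S : Type*} {X : S → Ω → ℂ} {Y : T → Ω → ℂ}
    {K : S → S → ℂ} {K' : T → T → ℂ} (hX : IsCircularGaussian X K μ)
    (hY : IsCircularGaussian Y K' μ)
    (hXY : IndepFun (fun ω s => X s ω) (fun ω t => Y t ω) μ) :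
    IsCircularGaussian (Sum.elim X Y) (blockCov K K') μ := by
  have hind : ∀ s t, IndepFun (X s) (Y t) μ := fun s t =>
    hXY.comp (measurable_pi_apply s) (measurable_pi_apply t)
  have hmul : ∀ s t, ∫ ω, X s ω * Y t ω ∂μ = 0 := fun s t => by
    have := (hind s t).integral_mul_eq_mul_integral (hX.measurable s).aestronglyMeasurable
      (hY.measurable t).aestronglyMeasurable
    rw [hX.mean, zero_mul] at this
    exact this
  have hstar : ∀ s t, ∫ ω, X s ω * star (Y t ω) ∂μ = 0 := fun s t => by
    have := ((hind s t).comp measurable_id (continuous_star.measurable)).integral_mul_eq_mul_integral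
      (hX.measurable s).aestronglyMeasurable
      (continuous_star.measurable.comp (hY.measurable t)).aestronglyMeasurable
    rw [Function.id_comp, hX.mean, zero_mul] at this
    exact this
  refine ⟨?_, isGaussianProcess_sumElim hX.gaussian hY.gaussian hXY, ?_, ?_, ?_⟩
  · rintro (s | t)
    exacts [hX.measurable s, hY.measurable t]
  · rintro (s | t)
    exacts [hX.mean s, hY.mean t]
  · rintro (s | t) (s' | t')
    · exact hX.covariance s s'
    · exact hstar s t'
    · have := congrArg star (hstar s' t)
      rw [Complex.star_def, ← integral_conj] at this
      simpa [blockCov, mul_comm] using this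
    · exact hY.covariance t t'
  · rintro (s | t) (s' | t')
    · exact hX.pseudoCovariance s s'
    · exact hmul s t'
    · simpa [mul_comm] using hmul s' t
    · exact hY.pseudoCovariance t t'

end ComplexGaussian

/-! ### Decay of the one-ring correlation -/

section OneRing

/-- This is what the sector `[-π/3, π/3]` is for: the derivative of the phase `sin` stays away from
zero. -/
lemma one_half_le_cos {α : ℝ} (h1 : -(Real.pi / 3) ≤ α) (h2 : α ≤ Real.pi / 3) :
    1 / 2 ≤ Real.cos α := by
  rw [← Real.cos_abs, ← Real.cos_pi_div_three]
  exact Real.cos_le_cos_of_nonneg_of_le_pi (abs_nonneg _) (by linarith [Real.pi_pos])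
    (abs_le.2 ⟨h1, h2⟩)

lemma norm_exp_neg_I_mul (x y : ℝ) : ‖Complex.exp (-(Complex.I * x * y))‖ = 1 := by
  rw [show -(Complex.I * x * y) = ((-(x * y) : ℝ) : ℂ) * Complex.I by push_cast; ring]
  exact Complex.norm_exp_ofReal_mul_I _

/-- First-derivative van der Corput bound for the phase `sin` away from its critical points. -/
lemma norm_integral_exp_sin_mul_abs_le {a b : ℝ} (c : ℝ) (hab : a ≤ b)
    (ha : -(Real.pi / 3) ≤ a) (hb : b ≤ Real.pi / 3) :
    ‖∫ α in a..b, Complex.exp (-(Complex.I * c * Real.sin α))‖ * |c| ≤ 4 + 4 * (b - a) := by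
  rcases eq_or_ne c 0 with rfl | hc
  · simp; linarith
  have hcC : (c : ℂ) ≠ 0 := by exact_mod_cast hc
  have hcos : ∀ α ∈ Set.uIcc a b, 1 / 2 ≤ Real.cos α := fun α hα => by
    rw [Set.uIcc_of_le hab] at hα
    exact one_half_le_cos (ha.trans hα.1) (hα.2.trans hb)
  have hcos0 : ∀ α ∈ Set.uIcc a b, Real.cos α ≠ 0 := fun α hα => by
    linarith [hcos α hα]
  -- The integrand is `u * v'` with `v` of modulus `1 / |c|`, so integration by parts gains the
  -- factor `1 / |c|`. The two boundary terms cost `2` each, and `|u'| ≤ 4` on an interval of length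
  -- `b - a`.
  set u : ℝ → ℂ := fun α => ((Real.cos α)⁻¹ : ℝ)
  set u' : ℝ → ℂ := fun α => (Real.sin α / Real.cos α ^ 2 : ℝ)
  set v : ℝ → ℂ := fun α => Complex.exp (-(Complex.I * c * Real.sin α)) * (Complex.I / c)
  set v' : ℝ → ℂ := fun α => Real.cos α * Complex.exp (-(Complex.I * c * Real.sin α))
  have hu : ∀ α ∈ Set.uIcc a b, HasDerivAt u (u' α) α := fun α hα => by
    have := (Real.hasDerivAt_cos α).inv (hcos0 α hα)
    rw [neg_neg] at this
    exact this.ofReal_comp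
  have hv : ∀ α ∈ Set.uIcc a b, HasDerivAt v (v' α) α := fun α _ => by
    have h := ((((Real.hasDerivAt_sin α).ofReal_comp).const_mul (Complex.I * c)).neg.cexp).mul_const
      (Complex.I / c)
    refine h.congr_deriv ?_
    simp only [v']
    field_simp
    rw [Complex.I_sq]
    simp only [Pi.neg_apply]
    ring
  have hu'c : ContinuousOn u' (Set.uIcc a b) :=
    Complex.continuous_ofReal.comp_continuousOn
      (Real.continuous_sin.continuousOn.div (Real.continuous_cos.continuousOn.pow 2)
        fun α hα => pow_ne_zero 2 (hcos0 α hα))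
  have hv'c : Continuous v' := by fun_prop
  have hparts := intervalIntegral.integral_mul_deriv_eq_deriv_mul hu hv
    hu'c.intervalIntegrable (hv'c.intervalIntegrable a b)
  have hint : ∫ α in a..b, Complex.exp (-(Complex.I * c * Real.sin α)) =
      ∫ α in a..b, u α * v' α := by
    refine intervalIntegral.integral_congr fun α hα => ?_
    have : (Real.cos α : ℂ) ≠ 0 := by exact_mod_cast hcos0 α hα
    simp only [u, v', Complex.ofReal_inv]
    field_simp
  have hvn : ∀ α, ‖v α‖ = |c|⁻¹ := fun α => by
    simp only [v, norm_mul, norm_exp_neg_I_mul, norm_div, Complex.norm_I, Complex.norm_real,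
      Real.norm_eq_abs, one_mul, one_div]
  have hun : ∀ α ∈ Set.uIcc a b, ‖u α‖ ≤ 2 := fun α hα => by
    have := hcos α hα
    simp only [u, Complex.norm_real, norm_inv, Real.norm_eq_abs]
    rw [abs_of_pos (by linarith)]
    calc (Real.cos α)⁻¹ ≤ (1 / 2)⁻¹ := inv_anti₀ (by norm_num) this
      _ = 2 := by norm_num
  have hu'n : ∀ α ∈ Set.uIcc a b, ‖u' α‖ ≤ 4 := fun α hα => by
    have := hcos α hα
    simp only [u', Complex.norm_real, norm_div, norm_pow, Real.norm_eq_abs]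
    rw [abs_of_pos (by linarith : 0 < Real.cos α), div_le_iff₀ (by positivity)]
    have := Real.abs_sin_le_one α
    nlinarith
  have hI : ‖∫ α in a..b, u' α * v α‖ ≤ 4 * |c|⁻¹ * |b - a| := by
    refine intervalIntegral.norm_integral_le_of_norm_le_const fun α hα => ?_
    rw [norm_mul, hvn]
    exact mul_le_mul_of_nonneg_right (hu'n α (Set.uIoc_subset_uIcc hα)) (by positivity)
  rw [hint, hparts]
  have hc0 : 0 < |c| := abs_pos.2 hc
  have hb1 : ‖u b * v b‖ ≤ 2 * |c|⁻¹ := by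
    rw [norm_mul, hvn]
    exact mul_le_mul_of_nonneg_right (hun b Set.right_mem_uIcc) (by positivity)
  have ha1 : ‖u a * v a‖ ≤ 2 * |c|⁻¹ := by
    rw [norm_mul, hvn]
    exact mul_le_mul_of_nonneg_right (hun a Set.left_mem_uIcc) (by positivity)
  rw [abs_of_nonneg (sub_nonneg.2 hab)] at hI
  have h := (norm_sub_le (u b * v b - u a * v a) (∫ α in a..b, u' α * v α)).trans
    (add_le_add (norm_sub_le _ _) le_rfl)
  calc _ ≤ (2 * |c|⁻¹ + 2 * |c|⁻¹ + 4 * |c|⁻¹ * (b - a)) * |c| := by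
        gcongr
        exact h.trans (add_le_add (add_le_add hb1 ha1) hI)
    _ = 4 + 4 * (b - a) := by field_simp; ring

lemma oneRing_self (D θ : ℝ) {Δ : ℝ} (hΔ : 0 < Δ) (L m : ℕ) :
    oneRing D Δ θ L m m = 1 / (L : ℂ) := by
  have : (Δ : ℂ) ≠ 0 := by exact_mod_cast hΔ.ne'
  simp only [oneRing, sub_self, mul_zero, zero_mul, neg_zero, Complex.exp_zero,
    intervalIntegral.integral_const]
  rw [Complex.real_smul]
  push_cast
  rcases eq_or_ne (L : ℂ) 0 with h | h
  · simp [h]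
  · field_simp
    ring

lemma exists_oneRing_bound {D Δ θ : ℝ} (hD : 0 < D) (hΔ : 0 < Δ)
    (hθ : -(Real.pi / 3) ≤ θ - Δ ∧ θ + Δ ≤ Real.pi / 3) (L : ℕ) :
    ∃ C : ℝ, ∀ m n : ℕ, ‖oneRing D Δ θ L m n‖ * (1 + |(m : ℝ) - n|) ≤ C := by
  -- The summand `2 * Δ` is the trivial bound by the interval length; the other is the oscillatory
  -- bound with `c = 2πD(m - n)`, divided by `2πD`.
  refine ⟨‖(1 / (2 * Δ * L) : ℂ)‖ *
    (2 * Δ + (4 + 4 * (2 * Δ)) / (2 * Real.pi * D)), fun m n => ?_⟩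
  have hpos : 0 < 2 * Real.pi * D := by positivity
  set c : ℝ := 2 * Real.pi * D * ((m : ℝ) - n) with hc
  have e : ∀ α : ℝ, Complex.exp (-(Complex.I * 2 * Real.pi * D * ((m : ℂ) - n) * Real.sin α)) =
      Complex.exp (-(Complex.I * c * Real.sin α)) := fun α => by
    rw [hc]; push_cast; congr 1; ring
  rw [oneRing, norm_mul, mul_assoc]
  refine mul_le_mul_of_nonneg_left ?_ (norm_nonneg _)
  simp_rw [e]
  have h1 := norm_integral_exp_sin_mul_abs_le (a := -Δ + θ) (b := Δ + θ) c (by linarith)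
    (by linarith [hθ.1]) (by linarith [hθ.2])
  have h2 : ‖∫ α in (-Δ + θ)..(Δ + θ), Complex.exp (-(Complex.I * c * Real.sin α))‖ ≤
      1 * |(Δ + θ) - (-Δ + θ)| :=
    intervalIntegral.norm_integral_le_of_norm_le_const fun α _ => (norm_exp_neg_I_mul _ _).le
  rw [show (Δ + θ) - (-Δ + θ) = 2 * Δ by ring] at h1 h2
  rw [abs_of_pos (by positivity), one_mul] at h2
  rw [hc, abs_mul, abs_of_pos hpos] at h1
  rw [mul_add, mul_one]
  refine add_le_add h2 ?_
  rw [le_div_iff₀ hpos]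
  calc _ = _ := by ring
    _ ≤ _ := h1

end OneRing

/-! ### Rows of the DFT matrix and geometric sums of roots of unity -/

section Dft

lemma dftL_apply {N L : ℕ} (hLN : L ≤ N) (j : Fin N) (l : Fin L) :
    dftL hLN j l = Complex.exp (-(2 * Real.pi * Complex.I * (j : ℕ) / N)) ^ (l : ℕ) := by
  have hN : (0 : ℝ) < N := by exact_mod_cast j.pos
  have : (Real.sqrt N : ℂ) ≠ 0 := by exact_mod_cast (Real.sqrt_pos.2 hN).ne'
  simp only [dftL, dft, Matrix.smul_apply, Matrix.submatrix_apply, Matrix.of_apply, id,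
    smul_eq_mul, Fin.val_castLE]
  rw [mul_div_cancel₀ _ this, ← Complex.exp_nat_mul]
  congr 1
  ring

lemma dft_eq_dftL_div {N : ℕ} (j t : Fin N) :
    dft N j t = dftL le_rfl j t / (Real.sqrt N : ℂ) := by
  have hN : (0 : ℝ) < N := by exact_mod_cast j.pos
  have : (Real.sqrt N : ℂ) ≠ 0 := by exact_mod_cast (Real.sqrt_pos.2 hN).ne'
  simp only [dftL, Matrix.smul_apply, Matrix.submatrix_apply, id, smul_eq_mul, Fin.castLE_rfl]
  rw [mul_div_cancel_left₀ _ this]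

lemma exp_two_pi_div_pow_eq_one_iff {N : ℕ} (hN : 0 < N) (k : ℤ) (L : ℕ) :
    Complex.exp (2 * Real.pi * Complex.I * k / N) ^ L = 1 ↔ (N : ℤ) ∣ (L : ℤ) * k := by
  have hN' : (N : ℂ) ≠ 0 := by exact_mod_cast hN.ne'
  rw [← Complex.exp_nat_mul, Complex.exp_eq_one_iff]
  refine exists_congr fun n => ?_
  rw [show (L : ℂ) * (2 * Real.pi * Complex.I * k / N) =
    (L * k / N) * (2 * Real.pi * Complex.I) by ring,
    mul_left_inj' Complex.two_pi_I_ne_zero, div_eq_iff hN']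
  constructor
  · intro h
    rw [mul_comm (N : ℤ)]
    exact_mod_cast h
  · intro h
    rw [mul_comm (N : ℤ)] at h
    exact_mod_cast h

/-- Inner product of two rows of the truncated DFT matrix. -/
lemma sum_star_dftL_mul {N L : ℕ} (hLN : L ≤ N) (j k : Fin N) :
    ∑ l, star (dftL hLN j l) * dftL hLN k l =
      ∑ l ∈ Finset.range L,
        Complex.exp (2 * Real.pi * Complex.I * (((j : ℕ) : ℤ) - ((k : ℕ) : ℤ) : ℤ) / N) ^ l := by
  rw [Finset.sum_range]
  refine Finset.sum_congr rfl fun l _ => ?_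
  rw [dftL_apply, dftL_apply, star_pow, ← mul_pow, Complex.star_def, ← Complex.exp_conj,
    ← Complex.exp_add]
  congr 2
  simp only [map_neg, map_div₀, map_mul, Complex.conj_ofReal, Complex.conj_I, map_natCast,
    Complex.conj_ofNat]
  push_cast
  ring

lemma not_dvd_sub_of_ne {N : ℕ} {j k : Fin N} (hjk : j ≠ k) :
    ¬ (N : ℤ) ∣ ((j : ℕ) : ℤ) - ((k : ℕ) : ℤ) := by
  intro h
  have := Int.eq_zero_of_abs_lt_dvd h (by rw [abs_lt]; constructor <;> omega)
  exact hjk (Fin.ext (by omega))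

lemma exp_two_pi_div_ne_one {N : ℕ} {j k : Fin N} (hjk : j ≠ k) :
    Complex.exp (2 * Real.pi * Complex.I * (((j : ℕ) : ℤ) - ((k : ℕ) : ℤ) : ℤ) / N) ≠ 1 := by
  have h := exp_two_pi_div_pow_eq_one_iff j.pos (((j : ℕ) : ℤ) - ((k : ℕ) : ℤ)) 1
  rw [pow_one, Nat.cast_one, one_mul] at h
  exact fun h1 => not_dvd_sub_of_ne hjk (h.1 h1)

lemma sum_star_dftL_mul_self {N L : ℕ} (hLN : L ≤ N) (j : Fin N) :
    ∑ l, star (dftL hLN j l) * dftL hLN j l = L := by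
  rw [sum_star_dftL_mul]
  simp

/-- The sum is `(ζ ^ L - 1) / (ζ - 1)` for an `N`-th root of unity `ζ ≠ 1`. The divisibility
condition says precisely that the numerator does not vanish. -/
lemma sum_star_dftL_mul_ne_zero {N L : ℕ} (hLN : L ≤ N) {j k : Fin N} (hjk : j ≠ k)
    (h : ¬ (N : ℤ) ∣ (L : ℤ) * (((j : ℕ) : ℤ) - ((k : ℕ) : ℤ))) :
    ∑ l, star (dftL hLN j l) * dftL hLN k l ≠ 0 := by
  rw [sum_star_dftL_mul, geom_sum_eq (exp_two_pi_div_ne_one hjk)]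
  refine div_ne_zero ?_ (sub_ne_zero.2 (exp_two_pi_div_ne_one hjk))
  rw [sub_ne_zero, Ne, exp_two_pi_div_pow_eq_one_iff j.pos]
  exact h

/-- The DFT matrix is unitary. -/
lemma sum_star_dft_mul {N : ℕ} (j k : Fin N) :
    ∑ t, star (dft N j t) * dft N k t = if j = k then 1 else 0 := by
  have hN : (0 : ℝ) < N := by exact_mod_cast j.pos
  have hN0 : (N : ℂ) ≠ 0 := by exact_mod_cast j.pos.ne'
  have hsq : (Real.sqrt N : ℂ) * (Real.sqrt N : ℂ) = N := by
    rw [← Complex.ofReal_mul, Real.mul_self_sqrt hN.le, Complex.ofReal_natCast]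
  have e : ∀ t, star (dft N j t) * dft N k t =
      star (dftL le_rfl j t) * dftL le_rfl k t / N := fun t => by
    rw [dft_eq_dftL_div, dft_eq_dftL_div, star_div₀, Complex.star_def,
      Complex.conj_ofReal, div_mul_div_comm, hsq]
  simp_rw [e]
  rw [← Finset.sum_div]
  split_ifs with h
  · subst h
    rw [sum_star_dftL_mul_self, div_self hN0]
  -- With all `N` columns the numerator is `ζ ^ N - 1 = 0`.
  · rw [sum_star_dftL_mul, geom_sum_eq (exp_two_pi_div_ne_one h),
      (exp_two_pi_div_pow_eq_one_iff j.pos _ N).2 (dvd_mul_right _ _)]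
    simp

end Dft

/-! ### From empirical correlations to normalized inner products -/

section NormalizedInner

lemma normalizedInner_eq (y z : ℕ → ℂ) (n : ℕ) :
    normalizedInner y z n = (∑ i ∈ Finset.range n, star (y i) * z i) /
      (Real.sqrt (∑ i ∈ Finset.range n, Complex.normSq (y i)) *
        Real.sqrt (∑ i ∈ Finset.range n, Complex.normSq (z i)) : ℝ) := by
  simp only [normalizedInner, inner_smul_left, inner_smul_right, EuclideanSpace.norm_eq,
    PiLp.inner_apply, Finset.sum_range, Complex.normSq_eq_norm_sq]
  simp only [map_inv₀, Complex.conj_ofReal, RCLike.inner_apply, Complex.ofReal_mul,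
    Complex.star_def]
  have e : ∑ i : Fin n, z i * (starRingEnd ℂ) (y i) = ∑ i : Fin n, (starRingEnd ℂ) (y i) * z i :=
    Finset.sum_congr rfl fun i _ => mul_comm _ _
  rw [e, div_eq_mul_inv, mul_inv]
  ring

lemma sum_star_mul_self (y : ℕ → ℂ) (n : ℕ) :
    ∑ i ∈ Finset.range n, star (y i) * y i =
      ((∑ i ∈ Finset.range n, Complex.normSq (y i) : ℝ) : ℂ) := by
  push_cast
  exact Finset.sum_congr rfl fun i _ => (Complex.normSq_eq_conj_mul_self).symm

/-- The normalized inner product converges if the empirical correlations do and the limiting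
powers are positive. -/
lemma tendsto_normalizedInner {y z : ℕ → ℂ} {g : ℂ} {a b : ℝ} (ha : 0 < a) (hb : 0 < b)
    (hg : Tendsto (fun n : ℕ => (∑ i ∈ Finset.range n, star (y i) * z i) / n) atTop (𝓝 g))
    (hy : Tendsto (fun n : ℕ => (∑ i ∈ Finset.range n, star (y i) * y i) / n) atTop (𝓝 (a : ℂ)))
    (hz : Tendsto (fun n : ℕ => (∑ i ∈ Finset.range n, star (z i) * z i) / n)
      atTop (𝓝 (b : ℂ))) :
    Tendsto (normalizedInner y z) atTop (𝓝 (g / (Real.sqrt a * Real.sqrt b : ℝ))) := by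
  have real : ∀ {w : ℕ → ℂ} {c : ℝ}, Tendsto (fun n : ℕ =>
      (∑ i ∈ Finset.range n, star (w i) * w i) / n) atTop (𝓝 (c : ℂ)) →
      Tendsto (fun n : ℕ => Real.sqrt ((∑ i ∈ Finset.range n, Complex.normSq (w i)) / n))
        atTop (𝓝 (Real.sqrt c)) := fun {w c} h => by
    refine Tendsto.sqrt ?_
    have := (Complex.continuous_re.tendsto _).comp h
    rw [Complex.ofReal_re] at this
    refine this.congr fun n => ?_
    rw [Function.comp, sum_star_mul_self, ← Complex.ofReal_natCast, ← Complex.ofReal_div,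
      Complex.ofReal_re]
  have h := hg.div ((Complex.continuous_ofReal.tendsto _).comp ((real hy).mul (real hz)))
    (by exact_mod_cast (mul_pos (Real.sqrt_pos.2 ha) (Real.sqrt_pos.2 hb)).ne')
  refine h.congr' ?_
  -- For `n > 0` the factor `1 / n` of the numerator cancels against the two factors `1 / √n` of the
  -- norms.
  filter_upwards [eventually_gt_atTop 0] with n hn
  have hn' : (0 : ℝ) < n := by exact_mod_cast hn
  have hn0 : (n : ℂ) ≠ 0 := by exact_mod_cast hn.ne'
  rw [normalizedInner_eq, Pi.div_apply, Function.comp, Real.sqrt_div' _ hn'.le,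
    Real.sqrt_div' _ hn'.le, div_mul_div_comm, Real.mul_self_sqrt hn'.le, Complex.ofReal_div,
    Complex.ofReal_natCast, div_div_div_cancel_right₀ hn0]

/-- Sesquilinearity over finitely many sources. The statement is deterministic, so it can be used
for each outcome with weights that depend on it; random phases need no independence assumption. -/
lemma tendsto_average_star_sum_mul_sum {S : Type*} [Fintype S] {x : S → ℕ → ℂ} {κ : S → S → ℂ}
    (h : ∀ s t, Tendsto (fun n : ℕ => (∑ i ∈ Finset.range n, x s i * star (x t i)) / n)
      atTop (𝓝 (κ s t))) (β β' : S → ℂ) :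
    Tendsto (fun n : ℕ =>
        (∑ i ∈ Finset.range n, star (∑ s, β s * x s i) * ∑ t, β' t * x t i) / (n : ℂ))
      atTop (𝓝 (∑ s, ∑ t, star (β s) * β' t * κ t s)) := by
  have h' := tendsto_finsetSum (Finset.univ : Finset S) fun s _ =>
    tendsto_finsetSum (Finset.univ : Finset S) fun t _ => (h t s).const_mul (star (β s) * β' t)
  refine h'.congr fun n => ?_
  have e : ∑ i ∈ Finset.range n, star (∑ s, β s * x s i) * ∑ t, β' t * x t i =
      ∑ s, ∑ t, ∑ i ∈ Finset.range n, star (β s) * β' t * (x t i * star (x s i)) := by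
    have hi : ∀ i, star (∑ s, β s * x s i) * ∑ t, β' t * x t i =
        ∑ s, ∑ t, star (β s * x s i) * (β' t * x t i) := fun i => by
      rw [star_sum, Finset.sum_mul_sum]
    simp_rw [hi]
    rw [Finset.sum_comm]
    refine Finset.sum_congr rfl fun s _ => ?_
    rw [Finset.sum_comm]
    refine Finset.sum_congr rfl fun t _ => Finset.sum_congr rfl fun i _ => ?_
    rw [star_mul']
    ring
  rw [e, Finset.sum_div]
  refine Finset.sum_congr rfl fun s _ => ?_
  rw [Finset.sum_div]
  exact Finset.sum_congr rfl fun t _ => by rw [← Finset.mul_sum, mul_div_assoc]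

end NormalizedInner

/-! ### Correctness of the differential decoder -/

section Decoder

variable {NB : ℕ} {cB cA : Codeword NB}

lemma mem_ambiguous_observed {b : Fin NB} :
    b ∈ ambiguous (observed cB cA) ↔ cA b = !cB b := by
  rw [ambiguous, Finset.mem_filter]
  simp only [observed, Finset.mem_univ, true_and]
  cases cB b <;> cases cA b <;> simp

/-- The decoder is correct if the inner products vanish exactly where the transmitting node
differs from the one on the reference. -/
lemma separatedPair_observed (r : Fin NB) {I : Fin NB → ℂ}
    (h : ∀ b ∈ ambiguous (observed cB cA), I b ≠ 0 ↔ cB b = cB r) :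
    separatedPair (observed cB cA) I = s(cB, cA) := by
  have key : ∀ a b, candidate (observed cB cA) I a b =
      if cA b = !cB b then xor (xor (cB b) (cB r)) a else cB b := by
    intro a b
    by_cases hb : cA b = !cB b
    · have hI := h b (mem_ambiguous_observed.2 hb)
      have ho : observed cB cA b = 1 := by
        simp only [observed, hb]; cases cB b <;> rfl
      have hd : diffDigit (I b) = xor (cB b) (cB r) := by
        simp only [diffDigit, thresholdDigit, norm_pos_iff, hI]
        cases cB b <;> cases cB r <;> rfl
      simp [candidate, ho, hb, hd]
    · have ho : observed cB cA b = if cB b then 2 else 0 := by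
        simp only [observed]
        revert hb
        cases cB b <;> cases cA b <;> simp
      rw [if_neg hb]
      simp only [candidate, ho]
      cases cB b <;> simp
  -- On ambiguous positions the differential digit is `cB b ⊕ cB r`. The guess `a = cB r` undoes the
  -- shift and gives Bob's word; the opposite guess complements the ambiguous digits and gives
  -- Ava's.
  have pair : ∀ a, a = cB r → candidate (observed cB cA) I a = cB ∧
      candidate (observed cB cA) I (!a) = cA := by
    rintro a rfl
    constructor
    · funext b
      rw [key]
      split_ifs <;> simp
    · funext b
      rw [key]
      split_ifs with hb
      · rw [hb]; simp
      · revert hb; cases cB b <;> cases cA b <;> simp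
  rw [separatedPair]
  cases hr : cB r
  · obtain ⟨h1, h2⟩ := pair false hr.symm
    exact congrArg₂ (fun c c' => s(c, c')) h1 h2
  · obtain ⟨h1, h2⟩ := pair true hr.symm
    rw [Sym2.eq_swap]
    exact congrArg₂ (fun c c' => s(c, c')) h1 h2

end Decoder

/-! ### Almost sure limiting correlations of the sources -/

section Model

/-- Position of a scalar source (a path of Bob, a path of Ava, a noise sample) at an antenna. -/
def sourceIndex {N L : ℕ} : (Fin L ⊕ Fin L) ⊕ Fin N → ℕ →
    ((ℕ × Fin L) ⊕ (ℕ × Fin L)) ⊕ (ℕ × Fin N)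
  | .inl (.inl l), i => .inl (.inl (i, l))
  | .inl (.inr l), i => .inl (.inr (i, l))
  | .inr t, i => .inr (i, t)

/-- Power of a source. -/
def sourcePower {N : ℕ} (L : ℕ) (σ2 : ℝ) : (Fin L ⊕ Fin L) ⊕ Fin N → ℂ :=
  Sum.elim (fun _ => 1 / (L : ℂ)) fun _ => (σ2 : ℂ)

/-- Joint covariance of all sources. -/
def sourceCov (D Δ θB θA σ2 : ℝ) (N L : ℕ) :=
  blockCov (blockCov (channelCov D Δ θB L) (channelCov D Δ θA L)) (noiseCov σ2 N)

variable {Ω : Type*} [MeasurableSpace Ω] {μ : Measure Ω} {N L : ℕ} {D Δ θB θA σ2 : ℝ}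
  {hB hA : ℕ × Fin L → Ω → ℂ} {v : ℕ × Fin N → Ω → ℂ}

lemma IsFadingModel.isCircularGaussian (h : IsFadingModel μ D Δ θB θA σ2 hB hA v) :
    IsCircularGaussian (Sum.elim (Sum.elim hB hA) v) (sourceCov D Δ θB θA σ2 N L) μ := by
  refine (h.bob.sumElim h.ava h.indep_channels).sumElim h.noise ?_
  have hm : Measurable fun p : (ℕ × Fin L → ℂ) × (ℕ × Fin L → ℂ) => Sum.elim p.1 p.2 := by
    refine measurable_pi_iff.2 ?_
    rintro (s | s)
    · exact (measurable_pi_apply s).comp measurable_fst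
    · exact (measurable_pi_apply s).comp measurable_snd
  have e : (fun ω s => Sum.elim hB hA s ω) = (fun p : (ℕ × Fin L → ℂ) × (ℕ × Fin L → ℂ) =>
      Sum.elim p.1 p.2) ∘ fun ω => ((fun p => hB p ω), (fun p => hA p ω)) := by
    funext ω s
    rcases s with s | s <;> rfl
  rw [e]
  exact h.indep_noise.comp hm measurable_id

lemma sourceCov_same_antenna (hΔ : 0 < Δ) (s t : (Fin L ⊕ Fin L) ⊕ Fin N) (m : ℕ) :
    sourceCov D Δ θB θA σ2 N L (sourceIndex s m) (sourceIndex t m) =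
      if s = t then sourcePower L σ2 s else 0 := by
  rcases s with (s | s) | s <;> rcases t with (t | t) | t <;>
    simp [sourceCov, sourceIndex, blockCov, channelCov, noiseCov, sourcePower, oneRing_self, hΔ]

/-- The one-ring bound handles both channels. White noise is correlated only at lag zero, where the
weight is one, so it contributes `|σ2|`. -/
lemma exists_sourceCov_bound (hD : 0 < D) (hΔ : 0 < Δ)
    (hθB : -(Real.pi / 3) ≤ θB - Δ ∧ θB + Δ ≤ Real.pi / 3)
    (hθA : -(Real.pi / 3) ≤ θA - Δ ∧ θA + Δ ≤ Real.pi / 3) (σ2 : ℝ) (N L : ℕ) :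
    ∃ C : ℝ, ∀ (s t : (Fin L ⊕ Fin L) ⊕ Fin N) (m n : ℕ),
      ‖sourceCov D Δ θB θA σ2 N L (sourceIndex s m) (sourceIndex t n)‖ * (1 + |(m : ℝ) - n|)
        ≤ C := by
  obtain ⟨C₁, h₁⟩ := exists_oneRing_bound hD hΔ hθB L
  obtain ⟨C₂, h₂⟩ := exists_oneRing_bound hD hΔ hθA L
  have h₁0 : 0 ≤ C₁ := le_trans (by positivity) (h₁ 0 0)
  have h₂0 : 0 ≤ C₂ := le_trans (by positivity) (h₂ 0 0)
  have h₃0 := abs_nonneg σ2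
  refine ⟨C₁ + C₂ + |σ2|, fun s t m n => ?_⟩
  have h₁' := h₁ m n
  have h₂' := h₂ m n
  rcases s with (s | s) | s <;> rcases t with (t | t) | t <;>
    simp only [sourceCov, sourceIndex, blockCov, channelCov, noiseCov, norm_zero, zero_mul]
  any_goals positivity
  · split_ifs
    · linarith
    · simp; positivity
  · split_ifs
    · linarith
    · simp; positivity
  · split_ifs with h
    · obtain ⟨rfl, -⟩ := Prod.mk.inj h
      simp
      linarith
    · simp; positivity

/-- The only probabilistic input to the theorem. There are finitely many pairs of sources, so one
null set serves them all, and it does not depend on phases or codewords. -/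
lemma IsFadingModel.ae_tendsto_source [IsProbabilityMeasure μ]
    (h : IsFadingModel μ D Δ θB θA σ2 hB hA v) (hD : 0 < D) (hΔ : 0 < Δ)
    (hθB : -(Real.pi / 3) ≤ θB - Δ ∧ θB + Δ ≤ Real.pi / 3)
    (hθA : -(Real.pi / 3) ≤ θA - Δ ∧ θA + Δ ≤ Real.pi / 3) :
    ∀ᵐ ω ∂μ, ∀ s t : (Fin L ⊕ Fin L) ⊕ Fin N, Tendsto (fun n : ℕ =>
      (∑ i ∈ Finset.range n, Sum.elim (Sum.elim hB hA) v (sourceIndex s i) ω *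
        star (Sum.elim (Sum.elim hB hA) v (sourceIndex t i) ω)) / n) atTop
      (𝓝 (if s = t then sourcePower L σ2 s else 0)) := by
  obtain ⟨C, hC⟩ := exists_sourceCov_bound hD hΔ hθB hθA σ2 N L
  rw [ae_all_iff]
  intro s
  rw [ae_all_iff]
  intro t
  exact h.isCircularGaussian.ae_tendsto_average_mul_star (sourceIndex s) (sourceIndex t)
    (fun m => sourceCov_same_antenna hΔ s s m) (fun m => sourceCov_same_antenna hΔ t t m)
    (fun m => sourceCov_same_antenna hΔ s t m) (hC s s) (hC t t) (hC s t)

end Model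

/-! ### Received samples as combinations of sources -/

section ReceivedSamples

variable {N L : ℕ}

/-- Weight of a source in the sample received on subcarrier `j`. -/
def sourceWeight (hLN : L ≤ N) (j : Fin N) (xB xA : ℂ) : (Fin L ⊕ Fin L) ⊕ Fin N → ℂ :=
  Sum.elim (Sum.elim (fun l => xB * dftL hLN j l) fun l => xA * dftL hLN j l) fun t => dft N j t

lemma received_eq_sum (hLN : L ≤ N) (j : Fin N) (xB xA : ℂ) {Ω : Type*}
    (hB hA : ℕ × Fin L → Ω → ℂ) (v : ℕ × Fin N → Ω → ℂ) (ω : Ω) (i : ℕ) :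
    received hLN j xB xA (fun l => hB (i, l) ω) (fun l => hA (i, l) ω) (fun t => v (i, t) ω) =
      ∑ s, sourceWeight hLN j xB xA s * Sum.elim (Sum.elim hB hA) v (sourceIndex s i) ω := by
  simp only [received, Matrix.mulVec, dotProduct, Fintype.sum_sum_type, sourceWeight,
    Sum.elim_inl, Sum.elim_inr, sourceIndex, Finset.mul_sum, mul_assoc]

/-- Limiting correlation of the samples on subcarriers `j` and `k`. -/
def limitCorr (hLN : L ≤ N) (σ2 : ℝ) (j k : Fin N) (xB xA xB' xA' : ℂ) : ℂ :=
  (star xB * xB' + star xA * xA') / L * ∑ l, star (dftL hLN j l) * dftL hLN k l +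
    if j = k then (σ2 : ℂ) else 0

/-- The diagonal source correlations collapse the double sum. Unitarity of the DFT keeps the noise
white, so it appears only for `j = k`. -/
lemma sum_sourceWeight (hLN : L ≤ N) (σ2 : ℝ) (j k : Fin N) (xB xA xB' xA' : ℂ) :
    ∑ s, ∑ t, star (sourceWeight hLN j xB xA s) * sourceWeight hLN k xB' xA' t *
      (if t = s then sourcePower L σ2 t else 0) = limitCorr hLN σ2 j k xB xA xB' xA' := by
  simp only [mul_ite, mul_zero, Finset.sum_ite_eq', Finset.mem_univ, if_true,
    Fintype.sum_sum_type, sourceWeight, sourcePower, Sum.elim_inl, Sum.elim_inr]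
  have h := congrArg (· * (σ2 : ℂ)) (sum_star_dft_mul j k)
  simp only [Finset.sum_mul, ite_mul, one_mul, zero_mul] at h
  rw [h, limitCorr, Finset.mul_sum, ← Finset.sum_add_distrib]
  congr 1
  refine Finset.sum_congr rfl fun l _ => ?_
  rw [star_mul', star_mul']
  ring

lemma limitCorr_self (hLN : L ≤ N) (hL : 0 < L) (σ2 : ℝ) (j : Fin N) (xB xA : ℂ) :
    limitCorr hLN σ2 j j xB xA xB xA =
      ((Complex.normSq xB + Complex.normSq xA + σ2 : ℝ) : ℂ) := by
  have : (L : ℂ) ≠ 0 := by exact_mod_cast hL.ne'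
  rw [limitCorr, sum_star_dftL_mul_self, div_mul_cancel₀ _ this, if_pos rfl]
  push_cast
  rw [Complex.normSq_eq_conj_mul_self, Complex.normSq_eq_conj_mul_self]
  rfl

end ReceivedSamples

/-! ### Vanishing of pilot symbols -/

section Pilot

lemma pilot_false (ρ φ : ℝ) : pilot false ρ φ = 0 := by simp [pilot]

lemma pilot_true_ne_zero {ρ : ℝ} (hρ : 0 < ρ) (φ : ℝ) : pilot true ρ φ ≠ 0 := by
  have : (Real.sqrt ρ : ℂ) ≠ 0 := by exact_mod_cast (Real.sqrt_pos.2 hρ).ne'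
  simp [pilot, this]

end Pilot

end ICC

end

/-! ### The separation theorem -/

theorem proposition2 {Ω : Type*} [MeasurableSpace Ω] (μ : Measure Ω) [IsProbabilityMeasure μ]
    {N L NB : ℕ} (hL : 0 < L) (hLN : L ≤ N) (Ψ : Fin NB ↪ Fin N)
    (D Δ θB θA σ2 ρB ρA : ℝ) (hD : 0 < D) (hΔ : 0 < Δ)
    (hθB : -(Real.pi / 3) ≤ θB - Δ ∧ θB + Δ ≤ Real.pi / 3)
    (hθA : -(Real.pi / 3) ≤ θA - Δ ∧ θA + Δ ≤ Real.pi / 3)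
    (hσ : 0 ≤ σ2) (hρB : 0 < ρB) (hρA : 0 < ρA)
    (hB hA : ℕ × Fin L → Ω → ℂ) (v : ℕ × Fin N → Ω → ℂ)
    (hmodel : ICC.IsFadingModel μ D Δ θB θA σ2 hB hA v)
    (φB : Ω → ℝ) (φA : Fin NB → Ω → ℝ)
    (cB cA : ICC.Codeword NB) (r : Fin NB)
    (hr : (ICC.ambiguous (ICC.observed cB cA)).Nonempty →
      r ∈ ICC.ambiguous (ICC.observed cB cA))
    (hres : ∀ b ∈ ICC.ambiguous (ICC.observed cB cA), b ≠ r → cB b = cB r →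
      ¬ (N : ℤ) ∣ (L : ℤ) * (((Ψ r : ℕ) : ℤ) - ((Ψ b : ℕ) : ℤ))) :
    ICC.sep μ cB cA r (ICC.sample hLN Ψ ρB ρA cB cA φB φA hB hA v) = 0 := by
  rw [ICC.sep, ← ae_iff]
  -- From here on `ω` is fixed and the phases are mere constants.
  filter_upwards [hmodel.ae_tendsto_source hD hΔ hθB hθA] with ω hω
  set xB : Fin NB → ℂ := fun b => ICC.pilot (cB b) ρB (φB ω) with hxB
  set xA : Fin NB → ℂ := fun b => ICC.pilot (cA b) ρA (φA b ω) with hxA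
  set γ : Fin NB → Fin NB → ℂ := fun b b' =>
    ICC.limitCorr hLN σ2 (Ψ b) (Ψ b') (xB b) (xA b) (xB b') (xA b') with hγ
  set P : Fin NB → ℝ := fun b => Complex.normSq (xB b) + Complex.normSq (xA b) + σ2 with hP
  have hcorr : ∀ b b', Tendsto (fun n : ℕ => (∑ i ∈ Finset.range n,
      star (ICC.sample hLN Ψ ρB ρA cB cA φB φA hB hA v b ω i) *
        ICC.sample hLN Ψ ρB ρA cB cA φB φA hB hA v b' ω i) / (n : ℂ)) atTop
      (𝓝 (γ b b')) := fun b b' => by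
    have h := ICC.tendsto_average_star_sum_mul_sum hω
      (ICC.sourceWeight hLN (Ψ b) (xB b) (xA b)) (ICC.sourceWeight hLN (Ψ b') (xB b') (xA b'))
    rw [ICC.sum_sourceWeight] at h
    simp only [← ICC.received_eq_sum] at h
    exact h
  have hγP : ∀ b, γ b b = (P b : ℂ) := fun b => ICC.limitCorr_self hLN hL σ2 _ _ _
  have hBpos : ∀ b, cB b = true → xB b ≠ 0 := fun b hb => by
    simp only [hxB, hb]; exact ICC.pilot_true_ne_zero hρB _
  have hApos : ∀ b, cA b = true → xA b ≠ 0 := fun b hb => by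
    simp only [hxA, hb]; exact ICC.pilot_true_ne_zero hρA _
  have hBzero : ∀ b, cB b = false → xB b = 0 := fun b hb => by
    simp only [hxB, hb]; exact ICC.pilot_false _ _
  have hAzero : ∀ b, cA b = false → xA b = 0 := fun b hb => by
    simp only [hxA, hb]; exact ICC.pilot_false _ _
  -- Some node transmits on an ambiguous subcarrier, so the limiting power is positive even without
  -- noise.
  have hPpos : ∀ b ∈ ICC.ambiguous (ICC.observed cB cA), 0 < P b := fun b hb => by
    have hb := ICC.mem_ambiguous_observed.1 hb
    have h1 := Complex.normSq_nonneg (xB b)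
    have h2 := Complex.normSq_nonneg (xA b)
    cases hc : cB b
    · have := Complex.normSq_pos.2 (hApos b (by rw [hb, hc]; rfl))
      simp only [hP]; linarith
    · have := Complex.normSq_pos.2 (hBpos b hc)
      simp only [hP]; linarith
  have hγne : ∀ b ∈ ICC.ambiguous (ICC.observed cB cA), γ r b ≠ 0 ↔ cB b = cB r := by
    intro b hb
    have hrA := hr ⟨b, hb⟩
    -- At the reference itself the correlation is the power, and no divisibility condition is
    -- needed.
    rcases eq_or_ne b r with rfl | hbr
    · simp only [iff_true]
      rw [hγP]
      exact_mod_cast (hPpos b hb).ne'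
    have hΨ : Ψ r ≠ Ψ b := fun h => hbr (Ψ.injective h).symm
    have hL0 : (L : ℂ) ≠ 0 := by exact_mod_cast hL.ne'
    have hb' := ICC.mem_ambiguous_observed.1 hb
    have hr' := ICC.mem_ambiguous_observed.1 hrA
    have hval : γ r b = (star (xB r) * xB b + star (xA r) * xA b) / L *
        ∑ l, star (ICC.dftL hLN (Ψ r) l) * ICC.dftL hLN (Ψ b) l := by
      simp only [hγ, ICC.limitCorr, if_neg hΨ, add_zero]
    rw [hval]
    have hsum := fun hc => ICC.sum_star_dftL_mul_ne_zero hLN hΨ (hres b hb hbr hc)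
    generalize ∑ l, star (ICC.dftL hLN (Ψ r) l) * ICC.dftL hLN (Ψ b) l = g at hsum ⊢
    -- Exactly one symbol is nonzero on each of the two subcarriers. If the same node sends both,
    -- one product survives and `hsum` applies; otherwise both products vanish.
    cases hcb : cB b <;> cases hcr : cB r <;> rw [hcb] at hb' <;> rw [hcr] at hr'
    · have h1 := hApos b hb'
      have h2 := hApos r hr'
      simp [hBzero b hcb, h1, h2, hL0, hsum (hcb.trans hcr.symm)]
    · simp [hBzero b hcb, hAzero r hr']
    · simp [hBzero r hcr, hAzero b hb']
    · have h1 := hBpos b hcb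
      have h2 := hBpos r hcr
      simp [hAzero b hb', h1, h2, hL0, hsum (hcb.trans hcr.symm)]
  refine ⟨fun b => γ r b / (Real.sqrt (P r) * Real.sqrt (P b) : ℝ), fun b hb => ?_,
    ICC.separatedPair_observed r fun b hb => ?_⟩
  · exact ICC.tendsto_normalizedInner (hPpos r (hr ⟨b, hb⟩)) (hPpos b hb) (hcorr r b)
      (hγP r ▸ hcorr r r) (hγP b ▸ hcorr b b)
  · rw [← hγne b hb]
    have : ((Real.sqrt (P r) * Real.sqrt (P b) : ℝ) : ℂ) ≠ 0 := by
      exact_mod_cast (mul_pos (Real.sqrt_pos.2 (hPpos r (hr ⟨b, hb⟩)))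
        (Real.sqrt_pos.2 (hPpos b hb))).ne'
    simp only [ne_eq, div_eq_zero_iff, this, or_false]
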